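/- Let $1<k\le n\le 2k-1$. A $((k,n))$ quantum threshold secret sharing scheme for secrets of dimension $M$ consists of finite-dimensional Hilbert spaces $\mathcal H_1,\dots,\mathcal H_n$ (the shares of the $n$ parties) and a quantum operation (completely positive trace-preserving map) $\mathcal E$ that encodes the states $\rho$ of $\mathbb C^M$ into states of $\mathcal H_1\otimes\dots\otimes\mathcal H_n$ such that, writing $\mathcal E(\rho)_A$ for the reduced state of $\mathcal E(\rho)$ on the shares of $A\subseteq\{1,\dots,n\}$, - (recoverability) for every $A$ with $|A|\ge k$ there is a quantum operation $\mathcal R_A$ with $\mathcal R_A(\mathcal E(\rho)_A)=\rho$ for all states $\rho$; - (secrecy) for every $B$ with $|B|\le k-1$, the state $\mathcal E(\rho)_B$ does not depend on the state $\rho$. Let $D\subseteq\{1,\dots,n\}$ with $|D|=d\ge k$, and suppose that the secret is recovered by accessing the parties in $D$: each party $j\in D$ applies a quantum operation $\pi_j$ to its share and sends the output, a system with Hilbert space $H_j$ of finite dimension (for instance a subsystem of its share), to a combiner, and there is a quantum operation $\mathcal R$ with $$\mathcal R\Bigl(\bigl(\textstyle\bigotimes_{j\in D}\pi_j\bigr)\bigl(\mathcal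 E(\rho)_D\bigr)\Bigr)=\rho\qquad\text{for all states }\rho\text{ of }\mathbb C^M .$$ Then the total communication to the combiner from any $d-k+1$ of these $d$ parties has dimension at least $M$: for every $L\subseteq D$ with $|L|=d-k+1$, $$\prod_{j\in L}\dim H_j\ \ge\ M .$$ -/

import Mathlib

open scoped Matrix ComplexOrder

namespace QSS

/-- States of a finite-dimensional quantum system whose Hilbert space is `ℂ^a`:
positive semidefinite matrices of trace one (pure and mixed states). -/
def IsState {a : Type*} [Fintype a] (ρ : Matrix a a ℂ) : Prop :=
  ρ.PosSemidef ∧ ρ.trace = 1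

/-- Quantum operations from the system `ℂ^a` to the system `ℂ^b`, in operator-sum form:
`X ↦ ∑ᵢ Kᵢ X Kᵢ†` with `∑ᵢ Kᵢ† Kᵢ = 1`. -/
def IsChannel {a b : Type*} [Fintype a] [DecidableEq a] [Fintype b]
    (Φ : Matrix a a ℂ →ₗ[ℂ] Matrix b b ℂ) : Prop :=
  ∃ (r : ℕ) (K : Fin r → Matrix b a ℂ),
    ∑ i, (K i)ᴴ * K i = 1 ∧ ∀ X, Φ X = ∑ i, K i * X * (K i)ᴴ

/-- Partial trace: the reduced operator on the parties in `A` of an operator `X` on the composite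
system of all parties. A basis state of the composite system is a family of basis states, one for
each party. -/
def reduced {ι : Type*} [Fintype ι] [DecidableEq ι] {S : ι → Type*} [∀ i, Fintype (S i)]
    (A : Finset ι) (X : Matrix (∀ i, S i) (∀ i, S i) ℂ) :
    Matrix (∀ i : A, S i) (∀ i : A, S i) ℂ :=
  Matrix.of fun x y => ∑ c : (∀ i : {i // i ∉ A}, S i),
    X ((Equiv.piEquivPiSubtypeProd (· ∈ A) S).symm (x, c))
      ((Equiv.piEquivPiSubtypeProd (· ∈ A) S).symm (y, c))

/-- The tensor product `⨂ⱼ πⱼ` of linear maps on operators: each party `j` applies `πⱼ` locally. -/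
def tensorMap {ι : Type*} [Fintype ι] [DecidableEq ι] {S H : ι → Type*} [∀ i, Fintype (S i)]
    [∀ i, DecidableEq (S i)]
    (π : ∀ j, Matrix (S j) (S j) ℂ →ₗ[ℂ] Matrix (H j) (H j) ℂ) :
    Matrix (∀ j, S j) (∀ j, S j) ℂ →ₗ[ℂ] Matrix (∀ j, H j) (∀ j, H j) ℂ where
  toFun X := Matrix.of fun x y =>
    ∑ u, ∑ v, X u v * ∏ j, π j (Matrix.single (u j) (v j) 1) (x j) (y j)
  map_add' X Y := by
    ext x y
    simp [add_mul, Finset.sum_add_distrib]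
  map_smul' c X := by
    ext x y
    simp [mul_assoc, Finset.mul_sum]

/-- `tensorMap π` is the linear map that sends `⨂ⱼ Xⱼ` to `⨂ⱼ πⱼ(Xⱼ)`. -/
theorem tensorMap_prod {ι : Type*} [Fintype ι] [DecidableEq ι] {S H : ι → Type*}
    [∀ i, Fintype (S i)] [∀ i, DecidableEq (S i)]
    (π : ∀ j, Matrix (S j) (S j) ℂ →ₗ[ℂ] Matrix (H j) (H j) ℂ)
    (X : ∀ j, Matrix (S j) (S j) ℂ) :
    tensorMap π (Matrix.of fun u v => ∏ j, X j (u j) (v j)) =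
      Matrix.of fun x y => ∏ j, π j (X j) (x j) (y j) := by
  ext x y
  have h : ∀ j, π j (X j) (x j) (y j) =
      ∑ p : S j × S j, X j p.1 p.2 * π j (Matrix.single p.1 p.2 1) (x j) (y j) := by
    intro j
    conv_lhs => rw [Matrix.matrix_eq_sum_single (X j)]
    rw [Fintype.sum_prod_type]
    simp only [map_sum, Matrix.sum_apply]
    refine Finset.sum_congr rfl fun u _ => Finset.sum_congr rfl fun v _ => ?_
    have : Matrix.single u v (X j u v) = X j u v • Matrix.single u v (1 : ℂ) := by simp
    rw [this, map_smul]
    simp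
  simp only [tensorMap, LinearMap.coe_mk, AddHom.coe_mk, Matrix.of_apply, h]
  rw [Finset.prod_univ_sum, Fintype.piFinset_univ, ← Fintype.sum_prod_type']
  refine Fintype.sum_equiv (Equiv.arrowProdEquivProdArrow ι S S).symm _ _ fun p => ?_
  simp [Finset.prod_mul_distrib]

/-- The shares of the parties in `A` suffice to recover the secret encoded by `E`. -/
def CanRecover {σ : Type*} [Fintype σ] [DecidableEq σ]
    {ι : Type*} [Fintype ι] [DecidableEq ι] {S : ι → Type*} [∀ i, Fintype (S i)]
    [∀ i, DecidableEq (S i)]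
    (E : Matrix σ σ ℂ →ₗ[ℂ] Matrix (∀ i, S i) (∀ i, S i) ℂ) (A : Finset ι) : Prop :=
  ∃ R : Matrix (∀ i : A, S i) (∀ i : A, S i) ℂ →ₗ[ℂ] Matrix σ σ ℂ,
    IsChannel R ∧ ∀ ρ, IsState ρ → R (reduced A (E ρ)) = ρ

/-- The parties in `B` have no information about the secret encoded by `E`: the joint state of
their shares is the same for all secrets. -/
def NoInformation {σ : Type*} [Fintype σ]
    {ι : Type*} [Fintype ι] [DecidableEq ι] {S : ι → Type*} [∀ i, Fintype (S i)]
    (E : Matrix σ σ ℂ →ₗ[ℂ] Matrix (∀ i, S i) (∀ i, S i) ℂ) (B : Finset ι) : Prop :=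
  ∀ ρ ρ', IsState ρ → IsState ρ' → reduced B (E ρ) = reduced B (E ρ')

/-- The quantum operation `E` is the encoding of a `((k,n))` quantum threshold secret sharing
scheme, with secret system `ℂ^σ` and share system `ℂ^(S i)` of party `i`. -/
structure IsThresholdScheme {σ : Type*} [Fintype σ] [DecidableEq σ] {n : ℕ}
    {S : Fin n → Type*} [∀ i, Fintype (S i)] [∀ i, DecidableEq (S i)] (k : ℕ)
    (E : Matrix σ σ ℂ →ₗ[ℂ] Matrix (∀ i, S i) (∀ i, S i) ℂ) : Prop where
  one_lt : 1 < k
  le_parties : k ≤ n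
  parties_le : n ≤ 2 * k - 1
  isChannel : IsChannel E
  recoverability : ∀ A : Finset (Fin n), k ≤ A.card → CanRecover E A
  secrecy : ∀ B : Finset (Fin n), B.card ≤ k - 1 → NoInformation E B

/-- The combiner recovers the secret encoded by `E` by accessing the parties in `D`: each party
`j ∈ D` applies the quantum operation `π j` to its share and sends the resulting system (for
instance a subsystem of the share) to the combiner, who decodes the secret from the systems
received. -/
def RecoversByCommunication {σ : Type*} [Fintype σ] [DecidableEq σ]
    {ι : Type*} [Fintype ι] [DecidableEq ι] {S H : ι → Type*} [∀ i, Fintype (S i)]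
    [∀ i, DecidableEq (S i)] [∀ i, Fintype (H i)] [∀ i, DecidableEq (H i)]
    (E : Matrix σ σ ℂ →ₗ[ℂ] Matrix (∀ i, S i) (∀ i, S i) ℂ) (D : Finset ι)
    (π : ∀ j : D, Matrix (S j) (S j) ℂ →ₗ[ℂ] Matrix (H j) (H j) ℂ) : Prop :=
  (∀ j, IsChannel (π j)) ∧
    ∃ R : Matrix (∀ j : D, H j) (∀ j : D, H j) ℂ →ₗ[ℂ] Matrix σ σ ℂ,
      IsChannel R ∧ ∀ ρ, IsState ρ → R (tensorMap π (reduced D (E ρ))) = ρ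

end QSS

/-! The parties in D \ L number k - 1, so the systems they send have a state independent of the
secret. Write β for those systems, l for what L sends, `K i` for the Kraus operators of encoding
plus local operations, `R j` for those of the decoder. `card_le_of_recovers` estimates ∑ |tr (R j *
K i)|² twice. Since decoding gives the identity, the sum is M². Each trace is also the trace of an l
× l matrix `t j i`, got by contracting over the secret and β, so by Cauchy–Schwarz its square is at
most |l| times the squared Hilbert–Schmidt norm of `t j i`. Those squared norms total exactly |l|,
because only the secret-independent marginal on β enters. Hence M² ≤ |l|². `sum_tensorMap_reduced`
shows that the marginal on β is determined by the shares of D \ L. -/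

namespace QSS

open Matrix

/-! ### Linear extension from states to all operators. -/

/-- A linear map that vanishes on all states vanishes. -/
theorem linearMap_eq_zero_of_state {a W : Type*} [Fintype a] [DecidableEq a] [AddCommGroup W]
    [Module ℂ W] (f : Matrix a a ℂ →ₗ[ℂ] W) (hf : ∀ ρ, IsState ρ → f ρ = 0) : f = 0 := by
  have hpsd : ∀ P : Matrix a a ℂ, P.PosSemidef → f P = 0 := by
    intro P hP
    by_cases ht : P.trace = 0
    · rw [hP.trace_eq_zero_iff.1 ht, map_zero]
    · have hs : IsState (P.trace⁻¹ • P) := by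
        refine ⟨hP.smul (inv_nonneg.2 hP.trace_nonneg), ?_⟩
        rw [trace_smul, smul_eq_mul, inv_mul_cancel₀ ht]
      have := hf _ hs
      rw [map_smul] at this
      exact (smul_eq_zero.1 this).resolve_left (inv_ne_zero ht)
  have hv : ∀ v : a → ℂ, f (vecMulVec v (star v)) = 0 := fun v =>
    hpsd _ (posSemidef_vecMulVec_self_star v)
  have hxy : ∀ x y : a → ℂ, f (vecMulVec x (star y)) = 0 := by
    intro x y
    -- Polarization: x + y kills the sum of the two cross terms, x + iy their difference.
    have h1 := hv (x + y)
    have h2 := hv (x + Complex.I • y)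
    simp only [star_add, star_smul, add_vecMulVec, vecMulVec_add, smul_vecMulVec, vecMulVec_smul,
      map_add, map_smul, hv, smul_zero, add_zero, zero_add, Complex.star_def, Complex.conj_I]
      at h1 h2
    rw [add_eq_zero_iff_eq_neg'] at h1
    rw [h1, smul_neg, neg_smul, neg_neg, ← two_smul ℂ, smul_smul] at h2
    rw [h1, (smul_eq_zero.1 h2).resolve_left (by simp), neg_zero]
  refine LinearMap.ext fun X => ?_
  rw [matrix_eq_sum_single X, map_sum]
  refine Finset.sum_eq_zero fun u _ => ?_
  rw [map_sum]
  refine Finset.sum_eq_zero fun v _ => ?_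
  have : Matrix.single u v (X u v) = X u v • vecMulVec (Pi.single u 1) (star (Pi.single v 1)) := by
    rw [← Pi.single_star, star_one, ← single_eq_single_vecMulVec_single]
    simp
  rw [this, map_smul, hxy, smul_zero]

theorem isState_single {a : Type*} [Fintype a] [DecidableEq a] (i : a) :
    IsState (Matrix.single i i (1 : ℂ)) := by
  refine ⟨?_, by simp⟩
  have := posSemidef_vecMulVec_self_star (Pi.single i (1 : ℂ))
  rwa [← Pi.single_star, star_one, ← single_eq_single_vecMulVec_single] at this

/-- A linear map that is constant on states vanishes on traceless operators. -/
theorem apply_eq_zero_of_trace_eq_zero {a W : Type*} [Fintype a] [DecidableEq a] [AddCommGroup W]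
    [Module ℂ W] (f : Matrix a a ℂ →ₗ[ℂ] W)
    (hf : ∀ ρ ρ', IsState ρ → IsState ρ' → f ρ = f ρ') {X : Matrix a a ℂ} (hX : X.trace = 0) :
    f X = 0 := by
  rcases isEmpty_or_nonempty a with h | ⟨⟨i⟩⟩
  · rw [Subsingleton.elim X 0, map_zero]
  -- On states f agrees with the trace times a fixed value, hence everywhere.
  have h0 := linearMap_eq_zero_of_state
    (f - (Matrix.traceLinearMap a ℂ ℂ).smulRight (f (Matrix.single i i 1))) fun ρ hρ => by
      simp [hρ.2, hf ρ _ hρ (isState_single i)]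
  have := LinearMap.congr_fun h0 X
  simpa [hX] using this

/-! ### Operator-sum calculus. -/

/-- Complete positivity of a linear map on operators, in operator-sum form. -/
def IsCP {a b : Type*} [Fintype a] (Φ : Matrix a a ℂ →ₗ[ℂ] Matrix b b ℂ) : Prop :=
  ∃ (κ : Type) (_ : Fintype κ) (K : κ → Matrix b a ℂ), ∀ X, Φ X = ∑ i, K i * X * (K i)ᴴ

theorem IsChannel.isCP {a b : Type*} [Fintype a] [DecidableEq a] [Fintype b]
    {Φ : Matrix a a ℂ →ₗ[ℂ] Matrix b b ℂ} (h : IsChannel Φ) : IsCP Φ := by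
  obtain ⟨r, K, -, hK⟩ := h
  exact ⟨Fin r, inferInstance, K, hK⟩

theorem IsCP.comp {a b c : Type*} [Fintype a] [Fintype b]
    {Ψ : Matrix b b ℂ →ₗ[ℂ] Matrix c c ℂ} {Φ : Matrix a a ℂ →ₗ[ℂ] Matrix b b ℂ}
    (hΨ : IsCP Ψ) (hΦ : IsCP Φ) : IsCP (Ψ ∘ₗ Φ) := by
  obtain ⟨κ, _, K, hK⟩ := hΨ
  obtain ⟨κ', _, K', hK'⟩ := hΦ
  refine ⟨κ × κ', inferInstance, fun p => K p.1 * K' p.2, fun X => ?_⟩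
  simp only [LinearMap.comp_apply, hK, hK', Fintype.sum_prod_type, Matrix.mul_sum, Matrix.sum_mul,
    conjTranspose_mul, Matrix.mul_assoc]

theorem trace_sum_mul_mul_conjTranspose {a b κ : Type*} [Fintype a] [DecidableEq a] [Fintype b]
    [Fintype κ] {K : κ → Matrix b a ℂ} (hK : ∑ i, (K i)ᴴ * K i = 1) (X : Matrix a a ℂ) :
    (∑ i, K i * X * (K i)ᴴ).trace = X.trace := by
  rw [trace_sum]
  simp_rw [trace_mul_comm (K _ * X), ← Matrix.mul_assoc]
  rw [← trace_sum, ← Matrix.sum_mul, hK, Matrix.one_mul]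

theorem IsChannel.trace_apply {a b : Type*} [Fintype a] [DecidableEq a] [Fintype b]
    {Φ : Matrix a a ℂ →ₗ[ℂ] Matrix b b ℂ} (h : IsChannel Φ) (X : Matrix a a ℂ) :
    (Φ X).trace = X.trace := by
  obtain ⟨r, K, h1, hK⟩ := h
  rw [hK, trace_sum_mul_mul_conjTranspose h1]

/-! ### The dimension bound for a bipartite system β × l. -/

section Core

variable {σ β l κ κ' : Type*} [Fintype σ] [DecidableEq σ] [Fintype β] [DecidableEq β] [Fintype l]
  [DecidableEq l] [Fintype κ] [Fintype κ']

/-- The entanglement fidelity (up to normalization) of an operation in operator-sum form. -/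
theorem sum_apply_single_eq_normSq_trace (A : Matrix σ σ ℂ) :
    ∑ a : σ, ∑ a' : σ, (A * Matrix.single a a' (1 : ℂ) * Aᴴ) a a' = (Complex.normSq A.trace : ℂ) := by
  rw [← Complex.mul_conj, Matrix.trace, map_sum, Finset.sum_mul_sum]
  refine Finset.sum_congr rfl fun a _ => Finset.sum_congr rfl fun a' _ => ?_
  rw [Matrix.mul_assoc, Matrix.mul_apply]
  rw [Finset.sum_eq_single a]
  · simp [Matrix.diag]
  · intro b _ hb
    simp [Matrix.single_mul_apply_of_ne, hb]
  · simp

/-- Cauchy–Schwarz on the diagonal; the off-diagonal terms are added because only the full double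
sum can be evaluated later. -/
theorem normSq_sum_diag_le {l : Type*} [Fintype l] (t : l → l → ℂ) :
    Complex.normSq (∑ p, t p p) ≤ Fintype.card l * ∑ p, ∑ q, Complex.normSq (t p q) := by
  simp only [Complex.normSq_eq_norm_sq]
  calc ‖∑ p, t p p‖ ^ 2 ≤ (∑ p, ‖t p p‖) ^ 2 := by
        gcongr; exact norm_sum_le _ _
    _ ≤ Fintype.card l * ∑ p, ‖t p p‖ ^ 2 := by
        simpa using sq_sum_le_card_mul_sum_sq (s := Finset.univ) (f := fun p => ‖t p p‖)
    _ ≤ _ := by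
        gcongr with p
        exact Finset.single_le_sum (f := fun q => ‖t p q‖ ^ 2) (fun _ _ => by positivity)
          (Finset.mem_univ p)

/-- If a decoder recovers a quantum system from `β × l` while the marginal on `β` carries no
information, then `l` is at least as large as the recovered system. -/
theorem card_le_of_recovers (K : κ → Matrix (β × l) σ ℂ) (R : κ' → Matrix σ (β × l) ℂ)
    (hR : ∑ j, (R j)ᴴ * R j = 1)
    (hid : ∀ X : Matrix σ σ ℂ, ∑ j, R j * (∑ i, K i * X * (K i)ᴴ) * (R j)ᴴ = X)
    (hB : ∀ X : Matrix σ σ ℂ, X.trace = 0 →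
      ∀ b b', ∑ q, (∑ i, K i * X * (K i)ᴴ) (b, q) (b', q) = 0) :
    Fintype.card σ ≤ Fintype.card l := by
  rcases isEmpty_or_nonempty σ with h | ⟨⟨a₀⟩⟩
  · simp
  set Φ : Matrix σ σ ℂ → Matrix (β × l) (β × l) ℂ := fun X => ∑ i, K i * X * (K i)ᴴ with hΦ
  -- `K` is not assumed trace preserving; the trace is read off after the decoder, which preserves
  -- it.
  have htr : (Φ (Matrix.single a₀ a₀ 1)).trace = 1 := by
    have h1 := congrArg trace (hid (Matrix.single a₀ a₀ 1))
    rw [trace_sum_mul_mul_conjTranspose hR] at h1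
    simpa [hΦ] using h1
  let τ : β → β → ℂ := fun b b' => ∑ q, Φ (Matrix.single a₀ a₀ 1) (b, q) (b', q)
  have hτ : ∑ b, τ b b = 1 := by
    rw [← htr, Matrix.trace, Fintype.sum_prod_type]
    rfl
  -- Off-diagonal matrix units and differences of diagonal ones are traceless, so `hB` applies.
  have hmarg : ∀ a a' b b', ∑ q, Φ (Matrix.single a a' 1) (b, q) (b', q) =
      if a = a' then τ b b' else 0 := by
    intro a a' b b'
    split_ifs with h
    · subst h
      have := hB (Matrix.single a a 1 - Matrix.single a₀ a₀ 1) (by simp) b b'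
      simp only [Matrix.mul_sub, Matrix.sub_mul, Finset.sum_sub_distrib, Matrix.sub_apply] at this
      exact sub_eq_zero.1 this
    · exact hB _ (by simp [h]) b b'
  let t : κ' → κ → l → l → ℂ := fun j i p q => ∑ a, ∑ b, R j a (b, p) * K i (b, q) a
  have htrace : ∀ j i, (R j * K i).trace = ∑ p, t j i p p := by
    intro j i
    simp only [t, Matrix.trace, Matrix.diag, Matrix.mul_apply, Fintype.sum_prod_type]
    rw [Finset.sum_comm]
    rw [Finset.sum_congr rfl fun a _ => Finset.sum_comm]
    rw [Finset.sum_comm]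
    refine Finset.sum_congr rfl fun _ _ => Finset.sum_comm
  have hM : ((Fintype.card σ : ℂ)) ^ 2 = ((∑ j, ∑ i, Complex.normSq (R j * K i).trace : ℝ) : ℂ) := by
    push_cast
    simp_rw [← sum_apply_single_eq_normSq_trace]
    have : ∀ a a' : σ, (∑ j, ∑ i, (R j * K i * Matrix.single a a' (1 : ℂ) * (R j * K i)ᴴ) a a')
        = 1 := by
      intro a a'
      have h1 := congrFun (congrFun (hid (Matrix.single a a' 1)) a) a'
      simp only [Matrix.mul_sum, Matrix.sum_mul, Matrix.sum_apply, Matrix.single_apply_same] at h1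
      refine Eq.trans ?_ h1
      simp only [conjTranspose_mul, Matrix.mul_assoc]
    calc (Fintype.card σ : ℂ) ^ 2 = ∑ a : σ, ∑ a' : σ, (1 : ℂ) := by simp [sq]
      _ = ∑ a : σ, ∑ a' : σ,
          (∑ j, ∑ i, (R j * K i * Matrix.single a a' (1 : ℂ) * (R j * K i)ᴴ) a a') := by
        simp only [this]
      _ = _ := by
        rw [Finset.sum_congr rfl fun a _ => Finset.sum_comm, Finset.sum_comm]
        refine Finset.sum_congr rfl fun j _ => ?_
        rw [Finset.sum_congr rfl fun a _ => Finset.sum_comm, Finset.sum_comm]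
  have hKsum : ∀ a a' b b' q, Φ (Matrix.single a a' 1) (b, q) (b', q) =
      ∑ i, K i (b, q) a * star (K i (b', q) a') := by
    intro a a' b b' q
    simp only [hΦ, Matrix.sum_apply]
    refine Finset.sum_congr rfl fun i _ => ?_
    rw [Matrix.mul_assoc, Matrix.mul_apply, Finset.sum_eq_single a]
    · simp
    · intro b _ hb
      simp [Matrix.single_mul_apply_of_ne, hb]
    · simp
  -- Summing over i and q produces the marginal, which forces a = a'. Completeness of `R` then gives
  -- δ_{bb'}, so each p contributes tr τ = 1.
  have hsum : ((∑ j, ∑ i, ∑ p, ∑ q, Complex.normSq (t j i p q) : ℝ) : ℂ) = Fintype.card l := by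
    have hn : ∀ j i p q, (Complex.normSq (t j i p q) : ℂ) =
        ∑ a, ∑ a', ∑ b, ∑ b', R j a (b, p) * star (R j a' (b', p)) *
          (K i (b, q) a * star (K i (b', q) a')) := by
      intro j i p q
      rw [← Complex.mul_conj]
      simp only [t, map_sum, Finset.sum_mul_sum, map_mul]
      refine Finset.sum_congr rfl fun a _ => Finset.sum_congr rfl fun a' _ =>
        Finset.sum_congr rfl fun b _ => Finset.sum_congr rfl fun b' _ => ?_
      simp only [Complex.star_def]
      ring
    have h2 : ∀ j p, ∑ i, ∑ q, (Complex.normSq (t j i p q) : ℂ) =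
        ∑ b, ∑ b', (∑ a, R j a (b, p) * star (R j a (b', p))) * τ b b' := by
      intro j p
      simp only [hn]
      calc _ = ∑ a, ∑ a', ∑ b, ∑ b', R j a (b, p) * star (R j a' (b', p)) *
            ∑ z : κ × l, (K z.1 (b, z.2) a * star (K z.1 (b', z.2) a')) := by
            refine (Fintype.sum_prod_type' _).symm.trans ?_
            simp only [Finset.mul_sum]
            rw [Finset.sum_comm]
            refine Finset.sum_congr rfl fun a _ => ?_
            rw [Finset.sum_comm]
            refine Finset.sum_congr rfl fun a' _ => ?_
            rw [Finset.sum_comm]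
            refine Finset.sum_congr rfl fun b _ => ?_
            rw [Finset.sum_comm]
        _ = ∑ a, ∑ b, ∑ b', R j a (b, p) * star (R j a (b', p)) * τ b b' := by
            simp only [Fintype.sum_prod_type_right, ← hKsum, hmarg]
            refine Finset.sum_congr rfl fun a _ => ?_
            rw [Finset.sum_eq_single a (fun a' _ h => by simp [h.symm]) (by simp)]
            simp
        _ = _ := by
            rw [Finset.sum_comm]
            refine Finset.sum_congr rfl fun b _ => ?_
            rw [Finset.sum_comm]
            simp only [Finset.sum_mul]
    have h3 : ∀ b b' p, ∑ j, ∑ a, R j a (b, p) * star (R j a (b', p)) =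
        if b = b' then 1 else 0 := by
      intro b b' p
      have := congrFun (congrFun hR (b', p)) (b, p)
      simp only [Matrix.sum_apply, Matrix.mul_apply, conjTranspose_apply, Matrix.one_apply,
        Prod.mk.injEq, and_true] at this
      simp only [mul_comm, eq_comm (a := b)] at this ⊢
      exact this
    push_cast
    calc _ = ∑ j, ∑ p, ∑ i, ∑ q, (Complex.normSq (t j i p q) : ℂ) :=
          Finset.sum_congr rfl fun j _ => Finset.sum_comm
      _ = ∑ p, ∑ b, ∑ b', (∑ j, ∑ a, R j a (b, p) * star (R j a (b', p))) * τ b b' := by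
          simp only [h2]
          rw [Finset.sum_comm]
          refine Finset.sum_congr rfl fun p _ => ?_
          rw [Finset.sum_comm]
          refine Finset.sum_congr rfl fun b _ => ?_
          rw [Finset.sum_comm]
          simp only [Finset.sum_mul]
      _ = _ := by simp only [h3]; simp [hτ]
  have hle : (Fintype.card σ : ℝ) ^ 2 ≤ (Fintype.card l : ℝ) ^ 2 := by
    have hM' : (Fintype.card σ : ℝ) ^ 2 = ∑ j, ∑ i, Complex.normSq (R j * K i).trace := by
      exact_mod_cast hM
    have hsum' : ∑ j, ∑ i, ∑ p, ∑ q, Complex.normSq (t j i p q) = (Fintype.card l : ℝ) := by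
      exact_mod_cast hsum
    rw [hM', sq]
    refine le_of_le_of_eq ?_ (congrArg _ hsum')
    rw [Finset.mul_sum]
    refine Finset.sum_le_sum fun j _ => ?_
    rw [Finset.mul_sum]
    refine Finset.sum_le_sum fun i _ => ?_
    rw [htrace]
    exact normSq_sum_diag_le _
  have := (sq_le_sq₀ (Nat.cast_nonneg _) (Nat.cast_nonneg _)).1 hle
  exact_mod_cast this

end Core

/-! ### Partial traces and local operations on many parties. -/

section Composite

variable {ι : Type} [Fintype ι] [DecidableEq ι] {S H : ι → Type} [∀ i, Fintype (S i)]

/-- The partial trace as a linear map. -/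
def reducedLinear (A : Finset ι) :
    Matrix (∀ i, S i) (∀ i, S i) ℂ →ₗ[ℂ] Matrix (∀ i : A, S i) (∀ i : A, S i) ℂ where
  toFun := reduced A
  map_add' X Y := by
    ext x y
    simp [reduced, Finset.sum_add_distrib]
  map_smul' c X := by
    ext x y
    simp [reduced, Finset.mul_sum]

variable [∀ i, DecidableEq (S i)]

/-- Pairing a reduced operator with a kernel on the retained parties. -/
theorem sum_mul_reduced (A : Finset ι) (X : Matrix (∀ i, S i) (∀ i, S i) ℂ)
    (f : (∀ i : A, S i) → (∀ i : A, S i) → ℂ) :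
    ∑ x, ∑ y, reduced A X x y * f x y =
      ∑ w, ∑ w', if (∀ i, i ∉ A → w i = w' i) then
        X w w' * f (fun i => w i) (fun i => w' i) else 0 := by
  set e := Equiv.piEquivPiSubtypeProd (· ∈ A) S with he
  rw [← e.symm.sum_comp, Fintype.sum_prod_type]
  simp_rw [← e.symm.sum_comp (fun w' => ite _ _ _), Fintype.sum_prod_type]
  refine Finset.sum_congr rfl fun x _ => ?_
  rw [Finset.sum_comm]
  refine Finset.sum_congr rfl fun y _ => ?_
  simp only [reduced, Matrix.of_apply, Finset.sum_mul]
  refine Finset.sum_congr rfl fun c _ => ?_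
  rw [Finset.sum_eq_single c]
  · rw [if_pos]
    · congr 2 <;> (funext i; simp [e, Equiv.piEquivPiSubtypeProd])
    · intro i hi
      simp [e, Equiv.piEquivPiSubtypeProd, hi]
  · intro c' _ hc
    rw [if_neg]
    intro h
    apply hc
    funext i
    have := h i i.2
    simpa [e, Equiv.piEquivPiSubtypeProd, i.2] using this.symm
  · simp

theorem isCP_reducedLinear (A : Finset ι) : IsCP (reducedLinear (S := S) A) := by
  -- One Kraus operator 1 ⊗ ⟨c| per basis state c of the discarded parties.
  refine ⟨∀ i : {i // i ∉ A}, S i, inferInstance, fun c =>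
    (1 : Matrix (∀ i, S i) (∀ i, S i) ℂ).submatrix
      (fun x => (Equiv.piEquivPiSubtypeProd (· ∈ A) S).symm (x, c)) id, fun X => ?_⟩
  ext x y
  simp [reducedLinear, reduced, Matrix.sum_apply, Matrix.mul_apply, Matrix.one_apply]

theorem isCP_tensorMap [∀ i, Fintype (H i)]
    {π : ∀ j, Matrix (S j) (S j) ℂ →ₗ[ℂ] Matrix (H j) (H j) ℂ} (hπ : ∀ j, IsCP (π j)) :
    IsCP (tensorMap π) := by
  choose κ _ K hK using hπ
  refine ⟨∀ j, κ j, inferInstance, fun c => Matrix.of fun x u => ∏ j, K j (c j) (x j) (u j),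
    fun X => ?_⟩
  ext x y
  have h1 : ∀ j (u v : S j), π j (Matrix.single u v 1) (x j) (y j) =
      ∑ i, K j i (x j) u * star (K j i (y j) v) := by
    intro j u v
    rw [hK, Matrix.sum_apply]
    refine Finset.sum_congr rfl fun i _ => ?_
    rw [Matrix.mul_apply, Finset.sum_eq_single v]
    · simp
    · intro b _ hb
      simp [Matrix.mul_single_apply_of_ne, hb]
    · simp
  simp only [tensorMap, LinearMap.coe_mk, AddHom.coe_mk, Matrix.of_apply, h1, Matrix.sum_apply,
    Finset.prod_univ_sum, Fintype.piFinset_univ, Finset.mul_sum]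
  rw [Finset.sum_congr rfl fun u _ => Finset.sum_comm, Finset.sum_comm]
  refine Finset.sum_congr rfl fun c _ => ?_
  simp only [Matrix.mul_apply, Finset.sum_mul, Matrix.of_apply, conjTranspose_apply, star_prod,
    Finset.prod_mul_distrib]
  rw [Finset.sum_comm]
  refine Finset.sum_congr rfl fun v _ => Finset.sum_congr rfl fun u _ => ?_
  ring

/-- Tracing out the systems sent by the parties in `L` leaves an operator that depends only on the
shares of the parties outside `L`. -/
theorem sum_tensorMap_reduced [∀ i, Fintype (H i)] (D L : Finset ι)
    {π : ∀ j : D, Matrix (S j) (S j) ℂ →ₗ[ℂ] Matrix (H j) (H j) ℂ} (hπ : ∀ j, IsChannel (π j))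
    (X : Matrix (∀ i, S i) (∀ i, S i) ℂ) (b b' : ∀ j : {j : D // (j : ι) ∉ L}, H j) :
    ∑ q, tensorMap (S := fun j : D => S j) (H := fun j : D => H j) π (reduced D X)
        ((Equiv.piEquivPiSubtypeProd (fun j : D => (j : ι) ∉ L) fun j => H j).symm (b, q))
        ((Equiv.piEquivPiSubtypeProd (fun j : D => (j : ι) ∉ L) fun j => H j).symm (b', q)) =
      ∑ x, ∑ y, reduced (D \ L) X x y * ∏ j : {j : D // (j : ι) ∉ L},
        π j (Matrix.single (x ⟨j, Finset.mem_sdiff.2 ⟨j.1.2, j.2⟩⟩)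
          (y ⟨j, Finset.mem_sdiff.2 ⟨j.1.2, j.2⟩⟩) 1) (b j) (b' j) := by
  set e := Equiv.piEquivPiSubtypeProd (fun j : D => (j : ι) ∉ L) fun j => H j with he
  -- Trace preservation of `π j` for j ∈ L turns tracing out its output into tracing out the share.
  have key : ∀ u v : ∀ j : D, S j,
      ∑ q, ∏ j, π j (Matrix.single (u j) (v j) 1) (e.symm (b, q) j) (e.symm (b', q) j) =
        if (∀ j : {j : D // ¬ (j : ι) ∉ L}, u j = v j) then
          ∏ j : {j : D // (j : ι) ∉ L}, π j (Matrix.single (u j) (v j) 1) (b j) (b' j) else 0 := by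
    intro u v
    have h1 : ∀ q, ∏ j, π j (Matrix.single (u j) (v j) 1) (e.symm (b, q) j) (e.symm (b', q) j) =
        (∏ j : {j : D // (j : ι) ∉ L}, π j (Matrix.single (u j) (v j) 1) (b j) (b' j)) *
        ∏ j : {j : D // ¬ (j : ι) ∉ L}, π j (Matrix.single (u j) (v j) 1) (q j) (q j) := by
      intro q
      rw [← Fintype.prod_subtype_mul_prod_subtype (fun j : D => (j : ι) ∉ L)]
      congr 1
      · refine Finset.prod_congr rfl fun j _ => ?_
        have hj := j.2
        simp [e, Equiv.piEquivPiSubtypeProd, hj]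
      · refine Finset.prod_congr rfl fun j _ => ?_
        have hj := not_not.1 j.2
        simp [e, Equiv.piEquivPiSubtypeProd, hj]
    have h2 : ∀ j : D, ∑ q, π j (Matrix.single (u j) (v j) 1) q q =
        if u j = v j then 1 else 0 := by
      intro j
      refine ((hπ j).trace_apply _).trans ?_
      split_ifs with h
      · rw [h, trace_single_eq_same]
      · rw [trace_single_eq_of_ne _ _ _ h]
    simp only [h1]
    have h3 := Finset.prod_univ_sum (fun j : {j : D // ¬ (j : ι) ∉ L} => (Finset.univ : Finset (H j)))
      (fun j q => π j (Matrix.single (u j) (v j) 1) q q)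
    rw [Fintype.piFinset_univ] at h3
    rw [← Finset.mul_sum, ← h3]
    simp only [h2, Fintype.prod_ite_zero, Finset.prod_const_one, mul_ite, mul_one, mul_zero]
  have hl : ∀ Z, ∑ q, tensorMap (S := fun j : D => S j) (H := fun j : D => H j) π Z
      (e.symm (b, q)) (e.symm (b', q)) = ∑ u, ∑ v, Z u v * ∑ q, ∏ j,
        π j (Matrix.single (u j) (v j) 1) (e.symm (b, q) j) (e.symm (b', q) j) := by
    intro Z
    simp only [tensorMap, LinearMap.coe_mk, AddHom.coe_mk, Matrix.of_apply, Finset.mul_sum]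
    rw [Finset.sum_comm]
    exact Finset.sum_congr rfl fun u _ => Finset.sum_comm
  rw [hl]
  simp only [key]
  rw [sum_mul_reduced D X (fun u v => if (∀ j : {j : D // ¬ (j : ι) ∉ L}, u j = v j) then
    ∏ j : {j : D // (j : ι) ∉ L}, π j (Matrix.single (u j) (v j) 1) (b j) (b' j) else 0),
    sum_mul_reduced (D \ L) X (fun x y => ∏ j : {j : D // (j : ι) ∉ L},
        π j (Matrix.single (x ⟨j, Finset.mem_sdiff.2 ⟨j.1.2, j.2⟩⟩)
          (y ⟨j, Finset.mem_sdiff.2 ⟨j.1.2, j.2⟩⟩) 1) (b j) (b' j))]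
  refine Finset.sum_congr rfl fun w _ => Finset.sum_congr rfl fun w' _ => ?_
  -- Agreement outside D and agreement on L together are agreement outside D \ L.
  rw [mul_ite, mul_zero, ← ite_and]
  refine if_congr ⟨fun h i hi => ?_, fun h => ⟨fun i hi => h i ?_, fun j => h j ?_⟩⟩ rfl rfl
  · by_cases hD : i ∈ D
    · exact h.2 ⟨⟨i, hD⟩, fun hL => hi (Finset.mem_sdiff.2 ⟨hD, hL⟩)⟩
    · exact h.1 i hD
  · exact fun hi' => hi (Finset.mem_sdiff.1 hi').1
  · exact fun hj => j.2 (Finset.mem_sdiff.1 hj).2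

/-- If the parties in `D \ L` have no information about the secret, then the systems sent by the
parties in `L` to a combiner who recovers the secret from `D` are at least as large as the
secret. -/
theorem card_le_prod_of_recoversByCommunication {σ : Type*} [Fintype σ] [DecidableEq σ]
    [∀ i, Fintype (H i)] [∀ i, DecidableEq (H i)]
    (E : Matrix σ σ ℂ →ₗ[ℂ] Matrix (∀ i, S i) (∀ i, S i) ℂ) (hE : IsChannel E) (D L : Finset ι)
    (hLD : L ⊆ D) (π : ∀ j : D, Matrix (S j) (S j) ℂ →ₗ[ℂ] Matrix (H j) (H j) ℂ)
    (hrec : RecoversByCommunication E D π) (hB : NoInformation E (D \ L)) :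
    Fintype.card σ ≤ ∏ j ∈ L, Fintype.card (H j) := by
  obtain ⟨hπ, R, hR, hid⟩ := hrec
  let Φ : Matrix σ σ ℂ →ₗ[ℂ] Matrix (∀ j : D, H j) (∀ j : D, H j) ℂ :=
    tensorMap (S := fun j : D => S j) (H := fun j : D => H j) π ∘ₗ reducedLinear D ∘ₗ E
  have hΦ : IsCP Φ := (isCP_tensorMap fun j => (hπ j).isCP).comp
    ((isCP_reducedLinear D).comp hE.isCP)
  have hRΦ : ∀ X, R (Φ X) = X := fun X => by
    have := LinearMap.congr_fun (linearMap_eq_zero_of_state (R ∘ₗ Φ - LinearMap.id)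
      fun ρ hρ => sub_eq_zero.2 (hid ρ hρ)) X
    exact sub_eq_zero.1 this
  have hred : ∀ X : Matrix σ σ ℂ, X.trace = 0 → reduced (D \ L) (E X) = 0 := fun X hX =>
    apply_eq_zero_of_trace_eq_zero (reducedLinear (D \ L) ∘ₗ E) hB hX
  obtain ⟨κ, _, K, hK⟩ := hΦ
  obtain ⟨r, R', hR', hRK⟩ := hR
  -- The first factor, from D \ L, plays β; the second, indexed by ¬ j ∉ L, plays l.
  set e := Equiv.piEquivPiSubtypeProd (fun j : D => (j : ι) ∉ L) (fun j => H j) with he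
  have hsub : ∀ X, ∑ i, (K i).submatrix e.symm id * X * ((K i).submatrix e.symm id)ᴴ =
      (Φ X).submatrix e.symm e.symm := by
    intro X
    ext p q
    simp [hK, Matrix.sum_apply, Matrix.mul_apply]
  have hcard := card_le_of_recovers (fun i => (K i).submatrix e.symm id)
    (fun j => (R' j).submatrix id e.symm) ?_ ?_ ?_
  · refine hcard.trans (le_of_eq ?_)
    rw [Fintype.card_pi]
    refine Finset.prod_bij (fun j _ => (j : ι)) (fun j _ => not_not.1 j.2) ?_ ?_ fun _ _ => rfl
    · exact fun i _ j _ h => Subtype.ext (Subtype.ext h)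
    · exact fun j hj => ⟨⟨⟨j, hLD hj⟩, not_not.2 hj⟩, Finset.mem_univ _, rfl⟩
  · have h1 := congrArg (fun Y => Matrix.submatrix Y e.symm e.symm) hR'
    simp only [submatrix_one_equiv] at h1
    rw [← h1]
    ext p q
    simp [Matrix.sum_apply, Matrix.mul_apply]
  · intro X
    simp only [hsub]
    conv_rhs => rw [← hRΦ X, hRK]
    refine Finset.sum_congr rfl fun j _ => ?_
    rw [conjTranspose_submatrix, submatrix_mul_equiv, submatrix_mul_equiv, submatrix_id_id]
  · intro X hX b b'
    simp only [hsub, submatrix_apply]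
    refine (sum_tensorMap_reduced D L hπ (E X) b b').trans ?_
    simp [hred X hX]

end Composite

end QSS

theorem mainTheorem9 (n k M : ℕ) (s : Fin n → ℕ)
    (E : Matrix (Fin M) (Fin M) ℂ →ₗ[ℂ]
      Matrix (∀ i : Fin n, Fin (s i)) (∀ i : Fin n, Fin (s i)) ℂ)
    (hE : QSS.IsThresholdScheme k E)
    (D : Finset (Fin n)) (hD : k ≤ D.card)
    (h : Fin n → ℕ)
    (π : ∀ j : D, Matrix (Fin (s j)) (Fin (s j)) ℂ →ₗ[ℂ] Matrix (Fin (h j)) (Fin (h j)) ℂ)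
    (hrec : QSS.RecoversByCommunication (S := fun i => Fin (s i)) (H := fun i => Fin (h i)) E D π)
    (L : Finset (Fin n)) (hLD : L ⊆ D) (hL : L.card = D.card - k + 1) :
    M ≤ ∏ j ∈ L, h j := by
  have hB : QSS.NoInformation E (D \ L) := by
    -- |D \ L| = d - (d - k + 1) = k - 1, the largest size that secrecy covers.
    refine hE.secrecy _ ?_
    have := hE.one_lt
    rw [Finset.card_sdiff_of_subset hLD]
    omega
  simpa using QSS.card_le_prod_of_recoversByCommunication (S := fun i => Fin (s i))
    (H := fun i => Fin (h i)) E hE.isChannel D L hLD π hrec hB
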